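/- **Proposition.** For $z\in\mathbb C\setminus[1,\infty)$, $\operatorname{Re}s>0$, $\operatorname{Re}v>0$ let $$\Phi(z,s,v)=\frac1{\Gamma(s)}\int_0^\infty\frac{u^{s-1}e^{-vu}}{1-ze^{-u}}\,du$$ be the Lerch function (for $|z|<1$ it equals $\sum_{n\ge 0}(v+n)^{-s}z^n$). Let $m,t\in\mathbb C$ with $-1<\operatorname{Re}(m)\le-\tfrac12$, $-1<\operatorname{Im}(m)<-\tfrac12$, $-1<\operatorname{Re}(t)\le-\tfrac12$, $-1<\operatorname{Im}(t)<-\tfrac12$. Then the following double integral converges absolutely, and $$\int_0^\infty\!\int_0^\infty \frac{e^{-\frac{(x+2y)^2}{4y}}\,y^{-m-t-1}\left(y^mx^t-x^my^t\right)}{\log(x/y)}\,dx\,dy$$ $$=\frac{2^me^{i\pi m}}{\pi}\left(2\pi m\,\Phi\!\left(e^{2\pi i m},1,\tfrac{\pi-i\log2}{2\pi}\right)+i\,\Phi\!\left(e^{2\pi i m},2,\tfrac{\pi-i\log2}{2\pi}\right)\right)$$ $$\quad-\frac{2^te^{i\pi t}}{\pi}\left(2\pi t\,\Phi\!\left(e^{2\pi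 i t},1,\tfrac{\pi-i\log2}{2\pi}\right)+i\,\Phi\!\left(e^{2\pi i t},2,\tfrac{\pi-i\log2}{2\pi}\right)\right).$$ -/

import Mathlib

open MeasureTheory Set

/-- The Lerch function `Φ(z, s, v)`: for `0 < Re s`, `0 < Re v` and `z` outside the cut `[1, ∞)`,
the analytic continuation of `∑ zⁿ (v + n)⁻ˢ` (the series for `‖z‖ < 1`) through its integral
representation `Φ(z, s, v) = Γ(s)⁻¹ ∫₀^∞ u^(s-1) e^(-v u) / (1 - z e^(-u)) du`. -/
noncomputable def lerchPhi (z s v : ℂ) : ℂ :=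
  (1 / Complex.Gamma s) *
    ∫ u in Ioi (0 : ℝ),
      (u : ℂ) ^ (s - 1) * Complex.exp (-(v * u)) / (1 - z * Complex.exp (-(u : ℂ)))

/-- The integrand `e^(-(x+2y)²/(4y)) y^(-m-t-1) (y^m x^t - x^m y^t) / log (x/y)`, used for
`x, y > 0` (it is undefined only on the null set `x = y`). -/
noncomputable def expLogIntegrand (m t : ℂ) (x y : ℝ) : ℂ :=
  (Real.exp (-((x + 2 * y) ^ 2 / (4 * y))) : ℂ) * (y : ℂ) ^ (-m - t - 1) *
    ((y : ℂ) ^ m * (x : ℂ) ^ t - (x : ℂ) ^ m * (y : ℂ) ^ t) / (Real.log (x / y) : ℂ)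

/-! Putting `x = r y` turns the integrand into `exp (-(r + 2)² y / 4) (r^t - r^m) / log r`, Jacobian
included, and the `y`-integral gives the factor `4 / (r + 2)²`. The quotient is `t - m` times the
average of `r^a` over the segment from `m` to `t`. By Fubini it remains to integrate the Mellin
transform `∫ r^a / (r + 2)² dr = 2^(a-1) π a / sin (π a)`, a Beta integral, along that segment. The
Lerch combination enters as a primitive in `a` (`hasDerivAt_lerchPrimitive`): `z ∂_z` lowers the
order of `Φ(z, s, v)` up to a multiple `-v`, and the shift `v` is chosen so that these multiples
cancel the derivative of `2^a e^(iπa)`. The strip `-1 < Re a < 0` keeps `e^(2πia)` off the cut and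
is convex, so it contains the segment. -/

/-! ### The Mellin transform of `1 / (r + 2)²` -/

/-- The substitution `r = 2 x / (1 - x)` maps `(0, 1)` onto `(0, ∞)`. -/
theorem image_two_mul_div_one_sub :
    (fun x : ℝ => 2 * x / (1 - x)) '' Ioo 0 1 = Ioi 0 := by
  ext r
  simp only [mem_image, mem_Ioo, mem_Ioi]
  constructor
  · rintro ⟨x, ⟨h0, h1⟩, rfl⟩
    have : 0 < 1 - x := by linarith
    positivity
  · intro hr
    refine ⟨r / (r + 2), ⟨by positivity, ?_⟩, ?_⟩
    · rw [div_lt_one (by positivity)]; linarith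
    · have : r + 2 ≠ 0 := by positivity
      have h2 : 1 - r / (r + 2) = 2 / (r + 2) := by field_simp; ring
      rw [h2]; field_simp

theorem injOn_two_mul_div_one_sub : InjOn (fun x : ℝ => 2 * x / (1 - x)) (Ioo 0 1) := by
  intro x hx y hy h
  have h1 : 1 - x ≠ 0 := by linarith [hx.2]
  have h2 : 1 - y ≠ 0 := by linarith [hy.2]
  simp only at h
  rw [div_eq_div_iff h1 h2] at h
  linarith

theorem hasDerivWithinAt_two_mul_div_one_sub {x : ℝ} (hx : x ∈ Ioo (0 : ℝ) 1) :
    HasDerivWithinAt (fun x : ℝ => 2 * x / (1 - x)) (2 / (1 - x) ^ 2) (Ioo 0 1) x := by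
  have h1 : 1 - x ≠ 0 := by linarith [hx.2]
  have := ((hasDerivAt_id x).const_mul 2).div ((hasDerivAt_id x).const_sub 1) h1
  refine (this.congr_deriv ?_).hasDerivWithinAt
  simp only [id]
  congr 1
  ring

/-- Since `r + 2 = 2 / (1 - x)`, the Jacobian over `(r + 2)²` is the constant `1 / 2`. The exponents
are left unsimplified to match the Beta integrand with parameters `a + 1` and `1 - a`. -/
theorem abs_deriv_smul_cpow_div_add_two_sq (a : ℂ) {x : ℝ} (hx : x ∈ Ioo (0 : ℝ) 1) :
    |2 / (1 - x) ^ 2| • ((((2 * x / (1 - x) : ℝ) : ℂ) ^ a) / (((2 * x / (1 - x) : ℝ) : ℂ) + 2) ^ 2)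
      = (2 : ℂ) ^ (a - 1) * ((x : ℂ) ^ ((a + 1) - 1) * (1 - (x : ℂ)) ^ ((1 - a) - 1)) := by
  have h0 := hx.1
  have h1 : 0 < 1 - x := by linarith [hx.2]
  have hc : (1 - (x : ℂ)) ≠ 0 := by exact_mod_cast h1.ne'
  rw [abs_of_pos (by positivity), div_eq_mul_inv (2 * x), Complex.ofReal_mul,
    Complex.mul_cpow_ofReal_nonneg (by positivity) (by positivity), Complex.ofReal_mul,
    Complex.mul_cpow_ofReal_nonneg (by positivity) (by positivity), Complex.ofReal_inv,
    Complex.inv_cpow _ _ (by rw [Complex.arg_ofReal_of_nonneg h1.le]; exact Real.pi_pos.ne)]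
  have e1 : (1 - a) - 1 = -a := by ring
  have e2 : (a + 1) - 1 = a := by ring
  rw [e1, e2, Complex.cpow_neg, Complex.cpow_sub _ _ two_ne_zero, Complex.cpow_one]
  have e3 : ((2 : ℝ) : ℂ) * (x : ℂ) * ((1 - x : ℝ) : ℂ)⁻¹ + 2 = 2 * ((1 - x : ℝ) : ℂ)⁻¹ := by
    push_cast
    field_simp
    ring
  rw [e3, Complex.real_smul]
  push_cast
  have hca : (1 - (x : ℂ)) ^ a ≠ 0 := by
    rw [Complex.cpow_ne_zero_iff]; exact Or.inl hc
  field_simp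

theorem integrableOn_cpow_div_add_two_sq {a : ℂ} (h0 : -1 < a.re) (h1 : a.re < 1) :
    IntegrableOn (fun r : ℝ => (r : ℂ) ^ a / ((r : ℂ) + 2) ^ 2) (Ioi 0) := by
  rw [← image_two_mul_div_one_sub, integrableOn_image_iff_integrableOn_abs_deriv_smul
    measurableSet_Ioo (fun x hx => hasDerivWithinAt_two_mul_div_one_sub hx)
    injOn_two_mul_div_one_sub]
  rw [integrableOn_congr_fun (fun x hx => abs_deriv_smul_cpow_div_add_two_sq a hx)
    measurableSet_Ioo]
  have := Complex.betaIntegral_convergent (u := a + 1) (v := 1 - a) (by simp; linarith)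
    (by simp; linarith)
  rw [intervalIntegrable_iff_integrableOn_Ioo_of_le zero_le_one] at this
  exact this.const_mul _

/-- `B(a + 1, 1 - a) = a Γ(a) Γ(1 - a) / Γ(2)`, and the reflection formula applies. -/
theorem integral_cpow_div_add_two_sq {a : ℂ} (h0 : -1 < a.re) (h1 : a.re < 1) (ha : a ≠ 0) :
    ∫ r in Ioi (0 : ℝ), (r : ℂ) ^ a / ((r : ℂ) + 2) ^ 2 =
      (2 : ℂ) ^ (a - 1) * (Real.pi * a / Complex.sin (Real.pi * a)) := by
  rw [← image_two_mul_div_one_sub, integral_image_eq_integral_abs_deriv_smul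
    measurableSet_Ioo (fun x hx => hasDerivWithinAt_two_mul_div_one_sub hx)
    injOn_two_mul_div_one_sub]
  rw [setIntegral_congr_fun measurableSet_Ioo
    (fun x hx => abs_deriv_smul_cpow_div_add_two_sq a hx), integral_const_mul]
  congr 1
  have := Complex.Gamma_mul_Gamma_eq_betaIntegral (s := a + 1) (t := 1 - a) (by simp; linarith)
    (by simp; linarith)
  rw [Complex.betaIntegral, intervalIntegral.integral_of_le zero_le_one,
    integral_Ioc_eq_integral_Ioo, show a + 1 + (1 - a) = (1 : ℕ) + 1 by push_cast; ring,
    Complex.Gamma_nat_eq_factorial, Complex.Gamma_add_one a ha, mul_assoc,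
    Complex.Gamma_mul_Gamma_one_sub] at this
  simp only [Nat.factorial_one, Nat.cast_one, one_mul] at this
  rw [← this]
  ring

theorem integrableOn_rpow_div_add_two_sq {p : ℝ} (h0 : -1 < p) (h1 : p < 1) :
    IntegrableOn (fun r : ℝ => r ^ p / (r + 2) ^ 2) (Ioi 0) := by
  have := (integrableOn_cpow_div_add_two_sq (a := p) (by simpa) (by simpa)).norm
  refine (integrableOn_congr_fun (fun r hr => ?_) measurableSet_Ioi).mp this
  have hr : 0 < r := hr
  have e : ‖(r : ℂ) + 2‖ = r + 2 := by
    rw [show (r : ℂ) + 2 = ((r + 2 : ℝ) : ℂ) by push_cast; ring, Complex.norm_real,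
      Real.norm_of_nonneg (by positivity)]
  rw [norm_div, norm_pow, e, Complex.norm_cpow_eq_rpow_re_of_pos hr, Complex.ofReal_re]

/-! ### The quotient `(r^t - r^m) / log r` as an average over a segment -/

theorem Real.rpow_le_add_rpow_of_mem_uIcc {r a b p : ℝ} (hr : 0 < r) (hp : p ∈ uIcc a b) :
    r ^ p ≤ r ^ a + r ^ b := by
  have ha := Real.rpow_nonneg hr.le a
  have hb := Real.rpow_nonneg hr.le b
  rw [mem_uIcc] at hp
  rcases le_total 1 r with h | h <;> rcases hp with ⟨h1, h2⟩ | ⟨h1, h2⟩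
  · linarith [Real.rpow_le_rpow_of_exponent_le h h2]
  · linarith [Real.rpow_le_rpow_of_exponent_le h h2]
  · linarith [Real.rpow_le_rpow_of_exponent_ge hr h h1]
  · linarith [Real.rpow_le_rpow_of_exponent_ge hr h h1]

theorem norm_cpow_segment_le {r τ : ℝ} (hr : 0 < r) (hτ : τ ∈ Icc (0 : ℝ) 1) (m t : ℂ) :
    ‖(r : ℂ) ^ (m + τ * (t - m))‖ ≤ r ^ m.re + r ^ t.re := by
  rw [Complex.norm_cpow_eq_rpow_re_of_pos hr]
  refine Real.rpow_le_add_rpow_of_mem_uIcc hr ?_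
  rw [← segment_eq_uIcc]
  refine ⟨1 - τ, τ, by linarith [hτ.2], hτ.1, by ring, ?_⟩
  simp
  ring

/-- The quotient `(r ^ t - r ^ m) / log r`. -/
noncomputable def cpowSubDivLog (m t : ℂ) (r : ℝ) : ℂ :=
  ((r : ℂ) ^ t - (r : ℂ) ^ m) / (Real.log r : ℂ)

theorem cpowSubDivLog_eq_integral (m t : ℂ) {r : ℝ} (hr : 0 < r) (hr1 : r ≠ 1) :
    cpowSubDivLog m t r = (t - m) * ∫ τ in (0 : ℝ)..1, (r : ℂ) ^ (m + τ * (t - m)) := by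
  rcases eq_or_ne t m with rfl | htm
  · simp [cpowSubDivLog]
  have hl : (Real.log r : ℂ) ≠ 0 := by
    exact_mod_cast Real.log_ne_zero_of_pos_of_ne_one hr hr1
  have hs : t - m ≠ 0 := sub_ne_zero.mpr htm
  have hr0 : (r : ℂ) ≠ 0 := by exact_mod_cast hr.ne'
  have h : ∀ τ : ℝ, (r : ℂ) ^ (m + τ * (t - m)) =
      (r : ℂ) ^ m * Complex.exp ((Real.log r * (t - m)) * τ) := by
    intro τ
    rw [Complex.cpow_add _ _ hr0, Complex.cpow_def_of_ne_zero hr0 (τ * (t - m)),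
      Complex.ofReal_log hr.le]
    ring_nf
  simp_rw [h]
  rw [intervalIntegral.integral_const_mul, integral_exp_mul_complex (mul_ne_zero hl hs),
    cpowSubDivLog]
  have h1 : (r : ℂ) ^ t = (r : ℂ) ^ m * Complex.exp (Real.log r * (t - m) * (1 : ℝ)) := by
    rw [← h]; push_cast; ring_nf
  rw [h1]
  field_simp
  simp

theorem norm_cpowSubDivLog_le (m t : ℂ) {r : ℝ} (hr : 0 < r) :
    ‖cpowSubDivLog m t r‖ ≤ ‖t - m‖ * (r ^ m.re + r ^ t.re) := by
  rcases eq_or_ne r 1 with rfl | hr1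
  -- At `r = 1` the quotient is `0`, by division by `log 1 = 0`.
  · simp [cpowSubDivLog]
  rw [cpowSubDivLog_eq_integral m t hr hr1, norm_mul]
  gcongr
  refine (intervalIntegral.norm_integral_le_of_norm_le_const
    (C := r ^ m.re + r ^ t.re) fun τ hτ => ?_).trans (by simp)
  rw [uIoc_of_le zero_le_one] at hτ
  exact norm_cpow_segment_le hr ⟨hτ.1.le, hτ.2⟩ m t

theorem measurable_cpowSubDivLog (m t : ℂ) : Measurable (cpowSubDivLog m t) := by
  unfold cpowSubDivLog
  fun_prop

/-! ### Derivatives of the Lerch integrals in `z` -/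

section LerchDerivatives

open Filter Topology

/-- By compactness `‖1 - z s‖` has a positive minimum on `[0, 1]`; half of it serves both as radius
and as lower bound. This uniformity supplies the domination for differentiating under the integral.
-/
theorem exists_pos_le_norm_one_sub_mul {z : ℂ} (hz : ∀ s ∈ Icc (0 : ℝ) 1, 1 - z * s ≠ 0) :
    ∃ c > 0, ∀ s ∈ Icc (0 : ℝ) 1, ∀ w ∈ Metric.ball z c, c ≤ ‖1 - w * s‖ := by
  obtain ⟨s₀, hs₀, hmin⟩ := isCompact_Icc.exists_isMinOn (nonempty_Icc.mpr zero_le_one)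
    (f := fun s : ℝ => ‖1 - z * s‖) (by fun_prop)
  have hpos : 0 < ‖1 - z * s₀‖ := norm_pos_iff.mpr (hz s₀ hs₀)
  refine ⟨‖1 - z * s₀‖ / 2, by positivity, fun s hs w hw => ?_⟩
  have h1 : ‖1 - z * s₀‖ ≤ ‖1 - z * s‖ := hmin hs
  have h2 : ‖(w - z) * s‖ ≤ ‖1 - z * s₀‖ / 2 := by
    rw [norm_mul, Complex.norm_real, Real.norm_of_nonneg hs.1]
    rw [Metric.mem_ball, dist_eq_norm] at hw
    nlinarith [hs.1, hs.2, norm_nonneg (w - z)]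
  have h3 : ‖1 - z * s‖ ≤ ‖1 - w * s‖ + ‖(w - z) * s‖ := by
    refine (norm_add_le _ _).trans_eq' ?_
    congr 1; ring
  linarith

theorem exp_neg_mem_Icc {u : ℝ} (hu : 0 ≤ u) : Real.exp (-u) ∈ Icc (0 : ℝ) 1 :=
  ⟨(Real.exp_pos _).le, Real.exp_le_one_iff.mpr (by linarith)⟩

theorem exists_pos_le_norm_one_sub_mul_exp {z : ℂ} (hz : ∀ s ∈ Icc (0 : ℝ) 1, 1 - z * s ≠ 0) :
    ∃ c > 0, ∀ u : ℝ, 0 ≤ u → ∀ w ∈ Metric.ball z c, c ≤ ‖1 - w * Complex.exp (-(u : ℂ))‖ := by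
  obtain ⟨c, hc, h⟩ := exists_pos_le_norm_one_sub_mul hz
  refine ⟨c, hc, fun u hu w hw => ?_⟩
  simpa using h _ (exp_neg_mem_Icc hu) w hw

theorem one_sub_mul_exp_ne_zero {z : ℂ} (hz : ∀ s ∈ Icc (0 : ℝ) 1, 1 - z * s ≠ 0)
    {u : ℝ} (hu : 0 ≤ u) : 1 - z * Complex.exp (-(u : ℂ)) ≠ 0 := by
  simpa using hz _ (exp_neg_mem_Icc hu)

theorem norm_exp_neg_ofReal_le_one {u : ℝ} (hu : 0 ≤ u) : ‖Complex.exp (-(u : ℂ))‖ ≤ 1 := by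
  simpa [Complex.norm_exp] using hu

/-- Differentiation in `z` of `∫₀^∞ g(u) / (1 - z e^(-u)) du` off the cut `[1, ∞)`. -/
theorem hasDerivAt_integral_div_one_sub_mul_exp {g : ℝ → ℂ} (hg : IntegrableOn g (Ioi 0))
    {z : ℂ} (hz : ∀ s ∈ Icc (0 : ℝ) 1, 1 - z * s ≠ 0) :
    IntegrableOn (fun u : ℝ => g u / (1 - z * Complex.exp (-(u : ℂ)))) (Ioi 0) ∧
    IntegrableOn (fun u : ℝ => g u * Complex.exp (-(u : ℂ)) /
      (1 - z * Complex.exp (-(u : ℂ))) ^ 2) (Ioi 0) ∧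
    HasDerivAt (fun w : ℂ => ∫ u in Ioi (0 : ℝ), g u / (1 - w * Complex.exp (-(u : ℂ))))
      (∫ u in Ioi (0 : ℝ), g u * Complex.exp (-(u : ℂ)) /
        (1 - z * Complex.exp (-(u : ℂ))) ^ 2) z := by
  obtain ⟨c, hc, hcb⟩ := exists_pos_le_norm_one_sub_mul_exp hz
  have hmeas : ∀ w : ℂ, AEStronglyMeasurable
      (fun u : ℝ => g u / (1 - w * Complex.exp (-(u : ℂ)))) (volume.restrict (Ioi 0)) := by
    intro w
    exact (hg.aestronglyMeasurable.aemeasurable.div (by fun_prop)).aestronglyMeasurable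
  have hint : IntegrableOn (fun u : ℝ => g u / (1 - z * Complex.exp (-(u : ℂ)))) (Ioi 0) := by
    refine (hg.norm.const_mul c⁻¹).mono' (hmeas z) ?_
    filter_upwards [ae_restrict_mem measurableSet_Ioi] with u hu
    rw [norm_div, div_eq_inv_mul]
    gcongr
    exact hcb u (le_of_lt hu) z (Metric.mem_ball_self hc)
  refine ⟨hint, ?_⟩
  refine hasDerivAt_integral_of_dominated_loc_of_deriv_le
    (F' := fun w u => g u * Complex.exp (-(u : ℂ)) / (1 - w * Complex.exp (-(u : ℂ))) ^ 2)
    (bound := fun u => (c ^ 2)⁻¹ * ‖g u‖)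
    (Metric.ball_mem_nhds z hc) (Eventually.of_forall hmeas) hint ?_ ?_ (hg.norm.const_mul _) ?_
  · exact ((hg.aestronglyMeasurable.aemeasurable.mul (by fun_prop)).div
      (by fun_prop)).aestronglyMeasurable
  · filter_upwards [ae_restrict_mem measurableSet_Ioi] with u hu w hw
    rw [norm_div, norm_mul, norm_pow, div_eq_inv_mul]
    gcongr
    · exact hcb u (le_of_lt hu) w hw
    · exact mul_le_of_le_one_right (norm_nonneg _) (norm_exp_neg_ofReal_le_one (le_of_lt hu))
  · filter_upwards [ae_restrict_mem measurableSet_Ioi] with u hu w hw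
    have hne : 1 - w * Complex.exp (-(u : ℂ)) ≠ 0 :=
      norm_pos_iff.mp (hc.trans_le (hcb u (le_of_lt hu) w hw))
    have h1 := ((((hasDerivAt_id w).mul_const (Complex.exp (-(u : ℂ)))).const_sub 1).inv
      hne).const_mul (g u)
    refine h1.congr_deriv ?_
    simp only [id]
    ring

/-- The Lerch function of order one, without the Gamma factor. -/
noncomputable def lerchOne (v z : ℂ) : ℂ :=
  ∫ u in Ioi (0 : ℝ), Complex.exp (-(v * u)) / (1 - z * Complex.exp (-(u : ℂ)))

/-- The Lerch function of order two, without the Gamma factor. -/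
noncomputable def lerchTwo (v z : ℂ) : ℂ :=
  ∫ u in Ioi (0 : ℝ), (u : ℂ) * Complex.exp (-(v * u)) / (1 - z * Complex.exp (-(u : ℂ)))

theorem lerchPhi_one (z v : ℂ) : lerchPhi z 1 v = lerchOne v z := by
  simp [lerchPhi, lerchOne]

theorem lerchPhi_two (z v : ℂ) : lerchPhi z 2 v = lerchTwo v z := by
  have h : (2 : ℂ) - 1 = 1 := by norm_num
  simp [lerchPhi, lerchTwo, h]

variable {v z : ℂ}

theorem integrableOn_exp_neg_mul (hv : 0 < v.re) :
    IntegrableOn (fun u : ℝ => Complex.exp (-(v * u))) (Ioi 0) := by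
  have := integrableOn_exp_mul_complex_Ioi (a := -v) (by simpa) 0
  simpa using this

theorem integrableOn_mul_exp_neg_mul (hv : 0 < v.re) :
    IntegrableOn (fun u : ℝ => (u : ℂ) * Complex.exp (-(v * u))) (Ioi 0) := by
  have := integrableOn_rpow_mul_exp_neg_mul_rpow (p := 1) (s := 1) (b := v.re)
    (by norm_num) (by norm_num) hv
  refine Integrable.mono' this (by fun_prop) ?_
  filter_upwards [ae_restrict_mem measurableSet_Ioi] with u hu
  have hu : 0 < u := hu
  simp [Complex.norm_exp, abs_of_pos hu]

theorem tendsto_mul_exp_div_atTop (hv : 0 < v.re)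
    (hz : ∀ s ∈ Icc (0 : ℝ) 1, 1 - z * s ≠ 0) (k : ℕ) :
    Tendsto (fun u : ℝ => (u : ℂ) ^ k * Complex.exp (-(v * u)) /
      (1 - z * Complex.exp (-(u : ℂ)))) atTop (𝓝 0) := by
  obtain ⟨c, hc, hcb⟩ := exists_pos_le_norm_one_sub_mul_exp hz
  have hlim : Tendsto (fun u : ℝ => c⁻¹ * (u ^ (k : ℝ) * Real.exp (-v.re * u))) atTop (𝓝 0) := by
    simpa using (tendsto_rpow_mul_exp_neg_mul_atTop_nhds_zero k v.re hv).const_mul c⁻¹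
  refine squeeze_zero_norm' ?_ hlim
  filter_upwards [eventually_ge_atTop 0] with u hu
  rw [norm_div, div_eq_inv_mul]
  gcongr
  · exact hcb u hu z (Metric.mem_ball_self hc)
  · simp [Complex.norm_exp, abs_of_nonneg hu]

theorem hasDerivAt_exp_div (hz : ∀ s ∈ Icc (0 : ℝ) 1, 1 - z * s ≠ 0) {u : ℝ} (hu : 0 ≤ u) :
    HasDerivAt (fun u : ℝ => Complex.exp (-(v * u)) / (1 - z * Complex.exp (-(u : ℂ))))
      (-v * (Complex.exp (-(v * u)) / (1 - z * Complex.exp (-(u : ℂ)))) -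
        z * (Complex.exp (-(v * u)) * Complex.exp (-(u : ℂ)) /
          (1 - z * Complex.exp (-(u : ℂ))) ^ 2)) u := by
  have hne := one_sub_mul_exp_ne_zero hz hu
  have h1 : HasDerivAt (fun u : ℂ => Complex.exp (-(v * u)))
      (Complex.exp (-(v * u)) * -(v * 1)) u :=
    ((hasDerivAt_id (u : ℂ)).const_mul v).neg.cexp
  have h2 : HasDerivAt (fun u : ℂ => 1 - z * Complex.exp (-u))
      (-(z * (Complex.exp (-u) * -1))) u :=
    ((hasDerivAt_id (u : ℂ)).neg.cexp.const_mul z).const_sub 1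
  refine (h1.div h2 hne).comp_ofReal.congr_deriv ?_
  field_simp

/-- Integrating the `u`-derivative of `e^(-vu) / (1 - z e^(-u))` over `(0, ∞)` leaves the boundary
term `-1 / (1 - z)`. Stating the result for `z * d` avoids dividing by `z`. -/
theorem hasDerivAt_lerchOne (hv : 0 < v.re) (hz : ∀ s ∈ Icc (0 : ℝ) 1, 1 - z * s ≠ 0) :
    ∃ d, HasDerivAt (lerchOne v) d z ∧ z * d = 1 / (1 - z) - v * lerchOne v z := by
  obtain ⟨hi, hi', hd⟩ := hasDerivAt_integral_div_one_sub_mul_exp (integrableOn_exp_neg_mul hv) hz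
  refine ⟨_, hd, ?_⟩
  have := integral_Ioi_of_hasDerivAt_of_tendsto'
    (fun u (hu : u ∈ Ici (0 : ℝ)) => hasDerivAt_exp_div (v := v) hz hu)
    ((hi.const_mul (-v)).sub (hi'.const_mul z))
    (by simpa using tendsto_mul_exp_div_atTop hv hz 0)
  rw [integral_sub (hi.const_mul (-v)) (hi'.const_mul z), integral_const_mul,
    integral_const_mul] at this
  simp only [Complex.ofReal_zero, mul_zero, neg_zero, Complex.exp_zero, mul_one] at this
  rw [lerchOne]
  linear_combination -this

/-- Same integration with an extra factor `u`: the boundary term at `0` vanishes, and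
differentiating `u` produces the order-one integral. -/
theorem hasDerivAt_lerchTwo (hv : 0 < v.re) (hz : ∀ s ∈ Icc (0 : ℝ) 1, 1 - z * s ≠ 0) :
    ∃ d, HasDerivAt (lerchTwo v) d z ∧ z * d = lerchOne v z - v * lerchTwo v z := by
  have hw := (hasDerivAt_integral_div_one_sub_mul_exp (integrableOn_exp_neg_mul hv) hz).1
  obtain ⟨hi, hi', hd⟩ :=
    hasDerivAt_integral_div_one_sub_mul_exp (integrableOn_mul_exp_neg_mul hv) hz
  refine ⟨_, hd, ?_⟩
  have hder : ∀ u ∈ Ici (0 : ℝ), HasDerivAt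
      (fun u : ℝ => (u : ℂ) ^ 1 * Complex.exp (-(v * u)) / (1 - z * Complex.exp (-(u : ℂ))))
      (Complex.exp (-(v * u)) / (1 - z * Complex.exp (-(u : ℂ))) +
        (-v * ((u : ℂ) * Complex.exp (-(v * u)) / (1 - z * Complex.exp (-(u : ℂ)))) -
        z * ((u : ℂ) * Complex.exp (-(v * u)) * Complex.exp (-(u : ℂ)) /
          (1 - z * Complex.exp (-(u : ℂ))) ^ 2))) u := by
    intro u hu
    have h := (hasDerivAt_id u).ofReal_comp.mul (hasDerivAt_exp_div (v := v) hz hu)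
    refine (h.congr_deriv ?_).congr_of_eventuallyEq (Eventually.of_forall fun x => ?_)
    · simp only [id, Complex.ofReal_one]; ring
    · simp only [id, Pi.mul_apply, pow_one]; ring
  have hsub : IntegrableOn (fun u : ℝ =>
      -v * ((u : ℂ) * Complex.exp (-(v * u)) / (1 - z * Complex.exp (-(u : ℂ)))) -
        z * ((u : ℂ) * Complex.exp (-(v * u)) * Complex.exp (-(u : ℂ)) /
          (1 - z * Complex.exp (-(u : ℂ))) ^ 2)) (Ioi 0) :=
    (hi.const_mul (-v)).sub (hi'.const_mul z)
  have := integral_Ioi_of_hasDerivAt_of_tendsto' hder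
    (hw.add hsub)
    (tendsto_mul_exp_div_atTop hv hz 1)
  rw [integral_add hw hsub,
    integral_sub (hi.const_mul (-v)) (hi'.const_mul z), integral_const_mul,
    integral_const_mul] at this
  simp only [Complex.ofReal_zero, pow_one, zero_mul, zero_div, sub_zero] at this
  rw [lerchOne, lerchTwo]
  linear_combination -this

end LerchDerivatives

/-! ### A primitive of the Mellin transform -/

/-- A zero would make `e^(2πia)` a positive real, forcing `Re a` to be an integer. -/
theorem one_sub_exp_two_pi_mul_ne_zero {a : ℂ} (h0 : -1 < a.re) (h1 : a.re < 0) :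
    ∀ s ∈ Icc (0 : ℝ) 1, 1 - Complex.exp (2 * Complex.I * a * Real.pi) * s ≠ 0 := by
  intro s hs h
  rcases hs.1.eq_or_lt with rfl | hpos
  · simp at h
  have he : Complex.exp (2 * Complex.I * a * Real.pi) = Complex.exp ((-Real.log s : ℝ) : ℂ) := by
    have hs0 : (s : ℂ) ≠ 0 := by exact_mod_cast hpos.ne'
    rw [← Complex.ofReal_exp, Real.exp_neg, Real.exp_log hpos, Complex.ofReal_inv]
    rw [sub_eq_zero] at h
    exact eq_inv_of_mul_eq_one_left h.symm
  obtain ⟨n, hn⟩ := Complex.exp_eq_exp_iff_exists_int.mp he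
  have him := congrArg Complex.im hn
  simp only [Complex.mul_im, Complex.mul_re, Complex.I_re, Complex.I_im, Complex.ofReal_re,
    Complex.ofReal_im, Complex.re_ofNat, Complex.im_ofNat, Complex.add_im, Complex.intCast_re,
    Complex.intCast_im] at him
  have hn' : a.re = n := by
    have : Real.pi * (a.re - n) = 0 := by linear_combination him / 2
    have := (mul_eq_zero.mp this).resolve_left Real.pi_ne_zero
    linarith
  rw [hn'] at h0 h1
  have h2 : (-1 : ℤ) < n := by exact_mod_cast h0
  have h3 : n < (0 : ℤ) := by exact_mod_cast h1
  omega

/-- The parameter `(π - i log 2) / (2 π)`. -/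
noncomputable def lerchShift : ℂ := (Real.pi - Complex.I * Real.log 2) / (2 * Real.pi)

theorem lerchShift_re : lerchShift.re = 1 / 2 := by
  have h : lerchShift = ((1 / 2 : ℝ) : ℂ) + ((-(Real.log 2) / (2 * Real.pi) : ℝ) : ℂ) * Complex.I := by
    have : (Real.pi : ℂ) ≠ 0 := by exact_mod_cast Real.pi_ne_zero
    rw [lerchShift]
    push_cast
    field_simp
    ring
  rw [h, Complex.add_re, Complex.re_ofReal_mul, Complex.I_re, Complex.ofReal_re, mul_zero, add_zero]

/-- A primitive of `-2 π a 2 ^ a / sin (π a)` on the strip `-1 < Re a < 0`. -/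
noncomputable def lerchPrimitive (a : ℂ) : ℂ :=
  (2 : ℂ) ^ a * Complex.exp (Complex.I * Real.pi * a) / Real.pi *
    (2 * Real.pi * a * lerchOne lerchShift (Complex.exp (2 * Complex.I * a * Real.pi))
      + Complex.I * lerchTwo lerchShift (Complex.exp (2 * Complex.I * a * Real.pi)))

theorem hasDerivAt_lerchPrimitive {a : ℂ} (h0 : -1 < a.re) (h1 : a.re < 0) :
    HasDerivAt lerchPrimitive
      (-(4 * ((2 : ℂ) ^ (a - 1) * (Real.pi * a / Complex.sin (Real.pi * a))))) a := by
  have hpi : (Real.pi : ℂ) ≠ 0 := by exact_mod_cast Real.pi_ne_zero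
  have hz := one_sub_exp_two_pi_mul_ne_zero h0 h1
  have hv : 0 < lerchShift.re := by rw [lerchShift_re]; norm_num
  obtain ⟨d₁, hd₁, e₁⟩ := hasDerivAt_lerchOne hv hz
  obtain ⟨d₂, hd₂, e₂⟩ := hasDerivAt_lerchTwo hv hz
  have hexp : HasDerivAt (fun a : ℂ => Complex.exp (2 * Complex.I * a * Real.pi))
      (Complex.exp (2 * Complex.I * a * Real.pi) * (2 * Complex.I * 1 * Real.pi)) a :=
    (((hasDerivAt_id a).const_mul (2 * Complex.I)).mul_const (Real.pi : ℂ)).cexp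
  have hE : HasDerivAt (fun a : ℂ => Complex.exp (Complex.I * Real.pi * a))
      (Complex.exp (Complex.I * Real.pi * a) * (Complex.I * Real.pi * 1)) a :=
    ((hasDerivAt_id a).const_mul (Complex.I * Real.pi)).cexp
  have h2 : HasDerivAt (fun a : ℂ => (2 : ℂ) ^ a) ((2 : ℂ) ^ a * Complex.log 2 * 1) a :=
    (hasDerivAt_id a).const_cpow (Or.inl two_ne_zero)
  have hlin : HasDerivAt (fun a : ℂ => 2 * Real.pi * a) (2 * Real.pi * 1 : ℂ) a :=
    (hasDerivAt_id a).const_mul _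
  have hc₁ := HasDerivAt.comp a hd₁ hexp
  have hc₂ := HasDerivAt.comp a hd₂ hexp
  have hG := ((h2.mul hE).div_const (Real.pi : ℂ)).mul
    ((hlin.mul hc₁).add (hc₂.const_mul Complex.I))
  have hzE : Complex.exp (2 * Complex.I * a * Real.pi) = Complex.exp (Complex.I * Real.pi * a) ^ 2 := by
    rw [← Complex.exp_nat_mul]; congr 1; push_cast; ring
  have hz1 := hz 1 (by simp)
  rw [Complex.ofReal_one, mul_one] at hz1
  have hsin : Complex.sin (Real.pi * a) = ((Complex.exp (Complex.I * Real.pi * a))⁻¹ -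
      Complex.exp (Complex.I * Real.pi * a)) * Complex.I / 2 := by
    rw [Complex.sin, ← Complex.exp_neg]
    congr 4 <;> ring_nf
  -- This identity dictates the shift: the logarithmic derivative of `2^a e^(iπa)` equals `2πi v`,
  -- which cancels the `-v` terms of `e₁` and `e₂`.
  have hshift : 2 * Complex.I * Real.pi * lerchShift = Complex.I * Real.pi + Complex.log 2 := by
    have hl : Complex.log 2 = (Real.log 2 : ℂ) := by
      rw [Complex.ofReal_log zero_le_two]; norm_num
    rw [hl, lerchShift]
    field_simp
    linear_combination -(Real.log 2 : ℂ) * Complex.I_sq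
  refine hG.congr_deriv ?_
  simp only [Function.comp, Pi.mul_apply, Pi.add_apply]
  rw [hsin, Complex.cpow_sub _ _ two_ne_zero, Complex.cpow_one]
  have hl2 : Complex.log 2 = 2 * Complex.I * Real.pi * lerchShift - Complex.I * Real.pi := by
    rw [hshift]; ring
  rw [hl2]
  rw [hzE] at hz1 e₁ e₂ ⊢
  generalize lerchOne lerchShift (Complex.exp (Complex.I * Real.pi * a) ^ 2) = P at *
  generalize lerchTwo lerchShift (Complex.exp (Complex.I * Real.pi * a) ^ 2) = Q at *
  have hE0 := Complex.exp_ne_zero (Complex.I * Real.pi * a)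
  generalize Complex.exp (Complex.I * Real.pi * a) = E at *
  generalize (2 : ℂ) ^ a = T at *
  have hr : -(4 * (T / 2 * (Real.pi * a / ((E⁻¹ - E) * Complex.I / 2)))) =
      T * E / Real.pi * (4 * Real.pi ^ 2 * Complex.I * a * (1 / (1 - E ^ 2))) := by
    have : E⁻¹ - E = (1 - E ^ 2) / E := by field_simp
    rw [this]
    field_simp
    rw [Complex.I_sq]
    ring
  rw [hr]
  -- The coefficients of `e₁` and `e₂` are those of `z d₁` and `z d₂` in the derivative; `I_sq`
  -- cancels `2π P` against `i · 2πi P`. Only the `1 / (1 - E²)` term survives.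
  linear_combination (T * E / Real.pi * (4 * Real.pi ^ 2 * Complex.I * a)) * e₁ +
    (T * E / Real.pi * (2 * Complex.I ^ 2 * Real.pi)) * e₂ +
    (T * E / Real.pi * (2 * Real.pi * P)) * Complex.I_sq

/-! ### Reduction to a single integral by `x = r y` -/

/-- The integrand after the substitution `x = r y`, without the Jacobian. -/
noncomputable def ratioIntegrand (m t : ℂ) (r y : ℝ) : ℂ :=
  (Real.exp (-((r + 2) ^ 2 / 4) * y) : ℂ) * cpowSubDivLog m t r

theorem expLogIntegrand_mul_right (m t : ℂ) {r y : ℝ} (hr : 0 < r) (hy : 0 < y) :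
    expLogIntegrand m t (r * y) y = (y : ℂ)⁻¹ * ratioIntegrand m t r y := by
  have hy0 : (y : ℂ) ≠ 0 := by exact_mod_cast hy.ne'
  have hexp : -((r * y + 2 * y) ^ 2 / (4 * y)) = -((r + 2) ^ 2 / 4) * y := by
    field_simp
  rw [expLogIntegrand, ratioIntegrand, cpowSubDivLog, hexp, mul_div_cancel_right₀ _ hy.ne',
    Complex.ofReal_mul, Complex.mul_cpow_ofReal_nonneg hr.le hy.le,
    Complex.mul_cpow_ofReal_nonneg hr.le hy.le]
  have h1 : (y : ℂ) ^ (-m - t - 1) * ((y : ℂ) ^ m * (y : ℂ) ^ t) = (y : ℂ)⁻¹ := by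
    rw [← Complex.cpow_add _ _ hy0, ← Complex.cpow_add _ _ hy0, ← Complex.cpow_neg_one]
    congr 1; ring
  rw [← h1]
  ring

theorem integrableOn_ratioIntegrand_right (m t : ℂ) (r : ℝ) (hr : 0 < r) :
    IntegrableOn (fun y => ratioIntegrand m t r y) (Ioi 0) := by
  have h := integrableOn_exp_mul_Ioi (a := -((r + 2) ^ 2 / 4))
    (by have : 0 < (r + 2) ^ 2 / 4 := by positivity
        linarith) 0
  exact h.ofReal.mul_const _

theorem integral_exp_neg_sq_mul {r : ℝ} (hr : 0 < r) :
    ∫ y in Ioi (0 : ℝ), Real.exp (-((r + 2) ^ 2 / 4) * y) = 4 / (r + 2) ^ 2 := by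
  rw [integral_exp_mul_Ioi
    (by have : 0 < (r + 2) ^ 2 / 4 := by positivity
        linarith)]
  simp

theorem integral_ratioIntegrand_right (m t : ℂ) {r : ℝ} (hr : 0 < r) :
    ∫ y in Ioi (0 : ℝ), ratioIntegrand m t r y = 4 / ((r : ℂ) + 2) ^ 2 * cpowSubDivLog m t r := by
  simp only [ratioIntegrand]
  rw [integral_mul_const, integral_complex_ofReal, integral_exp_neg_sq_mul hr]
  push_cast
  rfl

theorem measurable_ratioIntegrand (m t : ℂ) :
    Measurable (fun p : ℝ × ℝ => ratioIntegrand m t p.1 p.2) := by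
  unfold ratioIntegrand
  have : Measurable fun p : ℝ × ℝ => cpowSubDivLog m t p.1 :=
    (measurable_cpowSubDivLog m t).comp measurable_fst
  exact Measurable.mul (by fun_prop) this

/-- Integrating the norm in `y` first leaves at most `4 ‖t - m‖ (r^(Re m) + r^(Re t)) / (r + 2)²`,
which is integrable for real parts in `(-1, 1)`. -/
theorem integrable_ratioIntegrand {m t : ℂ} (hm : -1 < m.re ∧ m.re < 1)
    (ht : -1 < t.re ∧ t.re < 1) :
    Integrable (fun p : ℝ × ℝ => ratioIntegrand m t p.1 p.2)
      ((volume.restrict (Ioi 0)).prod (volume.restrict (Ioi 0))) := by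
  have hmeas := (measurable_ratioIntegrand m t).aestronglyMeasurable
    (μ := (volume.restrict (Ioi (0 : ℝ))).prod (volume.restrict (Ioi 0)))
  rw [integrable_prod_iff hmeas]
  constructor
  · filter_upwards [ae_restrict_mem measurableSet_Ioi] with r hr
    exact integrableOn_ratioIntegrand_right m t r hr
  · have hb := ((integrableOn_rpow_div_add_two_sq hm.1 hm.2).add
      (integrableOn_rpow_div_add_two_sq ht.1 ht.2)).const_mul (4 * ‖t - m‖)
    refine hb.mono' hmeas.norm.integral_prod_right' ?_
    filter_upwards [ae_restrict_mem measurableSet_Ioi] with r hr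
    have hr : 0 < r := hr
    have h1 : ∀ y, ‖ratioIntegrand m t r y‖ =
        Real.exp (-((r + 2) ^ 2 / 4) * y) * ‖cpowSubDivLog m t r‖ := by
      intro y
      rw [ratioIntegrand, norm_mul, Complex.norm_real, Real.norm_of_nonneg (Real.exp_pos _).le]
    simp_rw [h1]
    rw [integral_mul_const, integral_exp_neg_sq_mul hr, Real.norm_of_nonneg (by positivity)]
    calc 4 / (r + 2) ^ 2 * ‖cpowSubDivLog m t r‖
        ≤ 4 / (r + 2) ^ 2 * (‖t - m‖ * (r ^ m.re + r ^ t.re)) := by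
          gcongr; exact norm_cpowSubDivLog_le m t hr
      _ = _ := by simp only [Pi.add_apply]; ring

theorem integrableOn_expLogIntegrand_left {m t : ℂ} {y : ℝ} (hy : 0 < y)
    (h : IntegrableOn (fun r => ratioIntegrand m t r y) (Ioi 0)) :
    IntegrableOn (fun x => expLogIntegrand m t x y) (Ioi 0) := by
  have := integrableOn_Ioi_comp_mul_right_iff (fun x => expLogIntegrand m t x y) 0 hy
  rw [zero_mul] at this
  rw [← this]
  exact IntegrableOn.congr_fun (h.const_mul _)
    (fun r hr => (expLogIntegrand_mul_right m t hr hy).symm) measurableSet_Ioi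

theorem integral_expLogIntegrand_left (m t : ℂ) {y : ℝ} (hy : 0 < y) :
    ∫ x in Ioi (0 : ℝ), expLogIntegrand m t x y =
      ∫ r in Ioi (0 : ℝ), ratioIntegrand m t r y := by
  have h := integral_comp_mul_right_Ioi' (fun x => expLogIntegrand m t x y) 0 hy
  rw [zero_mul] at h
  rw [← h, setIntegral_congr_fun measurableSet_Ioi
    (fun r hr => expLogIntegrand_mul_right m t hr hy), integral_const_mul, Complex.real_smul,
    mul_inv_cancel_left₀ (by exact_mod_cast hy.ne')]

theorem integral_norm_expLogIntegrand_left (m t : ℂ) {y : ℝ} (hy : 0 < y) :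
    ∫ x in Ioi (0 : ℝ), ‖expLogIntegrand m t x y‖ =
      ∫ r in Ioi (0 : ℝ), ‖ratioIntegrand m t r y‖ := by
  have h := integral_comp_mul_right_Ioi' (fun x => ‖expLogIntegrand m t x y‖) 0 hy
  rw [zero_mul] at h
  rw [← h, setIntegral_congr_fun measurableSet_Ioi
    (g := fun r => y⁻¹ * ‖ratioIntegrand m t r y‖)
    (fun r hr => by
      simp only
      rw [expLogIntegrand_mul_right m t hr hy, norm_mul, norm_inv, Complex.norm_real,
        Real.norm_of_nonneg hy.le]),
    integral_const_mul, smul_eq_mul, mul_inv_cancel_left₀ hy.ne']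

/-- The scaling `x = r y` preserves both the integrability and the `L¹` norm of each slice at fixed
`y`, so the product criterion transfers from `ratioIntegrand`. -/
theorem integrableOn_expLogIntegrand {m t : ℂ} (hm : -1 < m.re ∧ m.re < 1)
    (ht : -1 < t.re ∧ t.re < 1) :
    IntegrableOn (fun p : ℝ × ℝ => expLogIntegrand m t p.1 p.2) (Ioi 0 ×ˢ Ioi 0) := by
  have hK := integrable_ratioIntegrand hm ht
  have hmeas : Measurable (fun p : ℝ × ℝ => expLogIntegrand m t p.1 p.2) := by
    unfold expLogIntegrand
    fun_prop
  rw [IntegrableOn, Measure.volume_eq_prod, ← Measure.prod_restrict,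
    integrable_prod_iff' hmeas.aestronglyMeasurable]
  have hK' := (integrable_prod_iff' hK.aestronglyMeasurable).mp hK
  constructor
  · filter_upwards [ae_restrict_mem measurableSet_Ioi, hK'.1] with y hy h
    exact integrableOn_expLogIntegrand_left hy h
  · refine hK'.2.congr ?_
    filter_upwards [ae_restrict_mem measurableSet_Ioi] with y hy
    exact (integral_norm_expLogIntegrand_left m t hy).symm

theorem integral_expLogIntegrand_eq {m t : ℂ} (hm : -1 < m.re ∧ m.re < 1)
    (ht : -1 < t.re ∧ t.re < 1) :
    ∫ y in Ioi (0 : ℝ), ∫ x in Ioi (0 : ℝ), expLogIntegrand m t x y =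
      ∫ r in Ioi (0 : ℝ), 4 / ((r : ℂ) + 2) ^ 2 * cpowSubDivLog m t r := by
  rw [setIntegral_congr_fun measurableSet_Ioi
    (fun y hy => integral_expLogIntegrand_left m t hy),
    ← integral_integral_swap (integrable_ratioIntegrand hm ht)]
  exact setIntegral_congr_fun measurableSet_Ioi
    (fun r hr => integral_ratioIntegrand_right m t hr)

/-! ### Integration along the segment from `m` to `t` -/

theorem re_segment_mem {m t : ℂ} {τ : ℝ} (hτ : τ ∈ Icc (0 : ℝ) 1) (hm : -1 < m.re ∧ m.re < 0)
    (ht : -1 < t.re ∧ t.re < 0) :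
    -1 < (m + τ * (t - m)).re ∧ (m + τ * (t - m)).re < 0 := by
  have h := (convex_Ioo (-1 : ℝ) 0) hm ht (sub_nonneg.mpr hτ.2) hτ.1 (by ring)
  have e : (m + τ * (t - m)).re = (1 - τ) • m.re + τ • t.re := by simp; ring
  rw [e]
  exact h

theorem integral_cpowSubDivLog_eq {m t : ℂ} (hm : -1 < m.re ∧ m.re < 0)
    (ht : -1 < t.re ∧ t.re < 0) :
    ∫ r in Ioi (0 : ℝ), 4 / ((r : ℂ) + 2) ^ 2 * cpowSubDivLog m t r =
      lerchPrimitive m - lerchPrimitive t := by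
  let F : ℝ → ℝ → ℂ := fun r τ => (r : ℂ) ^ (m + τ * (t - m)) / ((r : ℂ) + 2) ^ 2
  have hF : Integrable (Function.uncurry F)
      ((volume.restrict (Ioi 0)).prod (volume.restrict (Ioc 0 1))) := by
    have hb := ((integrableOn_rpow_div_add_two_sq hm.1 (hm.2.trans one_pos)).add
      (integrableOn_rpow_div_add_two_sq ht.1 (ht.2.trans one_pos))).mul_prod
      (integrable_const (1 : ℝ) (μ := volume.restrict (Ioc (0 : ℝ) 1)))
    refine hb.mono' ?_ ?_
    · have : Measurable (Function.uncurry F) := by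
        unfold F Function.uncurry
        fun_prop
      exact this.aestronglyMeasurable
    · rw [Measure.prod_restrict]
      filter_upwards [ae_restrict_mem (measurableSet_Ioi.prod measurableSet_Ioc)] with p hp
      have hr : 0 < p.1 := hp.1
      have e : ‖(p.1 : ℂ) + 2‖ = p.1 + 2 := by
        rw [show (p.1 : ℂ) + 2 = ((p.1 + 2 : ℝ) : ℂ) by push_cast; ring, Complex.norm_real,
          Real.norm_of_nonneg (by positivity)]
      simp only [Function.uncurry, F, Pi.add_apply, mul_one]
      rw [norm_div, norm_pow, e, ← add_div]
      gcongr
      exact norm_cpow_segment_le hr ⟨hp.2.1.le, hp.2.2⟩ m t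
  have h1 : ∫ r in Ioi (0 : ℝ), 4 / ((r : ℂ) + 2) ^ 2 * cpowSubDivLog m t r =
      ∫ r in Ioi (0 : ℝ), 4 * (t - m) * ∫ τ in Ioc (0 : ℝ) 1, F r τ := by
    refine integral_congr_ae ?_
    filter_upwards [ae_restrict_mem measurableSet_Ioi,
      -- The average formula needs `r ≠ 1`, which excludes only a null set.
      ae_restrict_of_ae (Measure.ae_ne volume (1 : ℝ))] with r hr hr1
    rw [cpowSubDivLog_eq_integral m t hr hr1, integral_div,
      intervalIntegral.integral_of_le zero_le_one]
    ring
  rw [h1, integral_const_mul, integral_integral_swap hF, ← integral_const_mul]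
  -- The right side is shaped as the `τ`-derivative of `-lerchPrimitive (m + τ (t - m))`, ready for
  -- the fundamental theorem of calculus.
  have h2 : ∀ τ ∈ Ioc (0 : ℝ) 1, 4 * (t - m) * ∫ r in Ioi (0 : ℝ), F r τ =
      -(4 * ((2 : ℂ) ^ ((m + τ * (t - m)) - 1) * (Real.pi * (m + τ * (t - m)) /
        Complex.sin (Real.pi * (m + τ * (t - m)))))) * -(t - m) := by
    intro τ hτ
    have hs := re_segment_mem ⟨hτ.1.le, hτ.2⟩ hm ht
    rw [integral_cpow_div_add_two_sq hs.1 (hs.2.trans one_pos)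
      -- The exponent is nonzero because its real part is negative.
      (fun h => by rw [h] at hs; simp at hs)]
    ring
  have hint := IntegrableOn.congr_fun (hF.integral_prod_right.const_mul (4 * (t - m))) h2
    measurableSet_Ioc
  rw [setIntegral_congr_fun measurableSet_Ioc h2, ← intervalIntegral.integral_of_le zero_le_one]
  rw [← intervalIntegrable_iff_integrableOn_Ioc_of_le zero_le_one] at hint
  have hder : ∀ τ ∈ uIcc (0 : ℝ) 1,
      HasDerivAt (fun τ : ℝ => -lerchPrimitive (m + τ * (t - m)))
        (-(4 * ((2 : ℂ) ^ ((m + τ * (t - m)) - 1) * (Real.pi * (m + τ * (t - m)) /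
          Complex.sin (Real.pi * (m + τ * (t - m)))))) * -(t - m)) τ := by
    intro τ hτ
    rw [uIcc_of_le zero_le_one] at hτ
    have hs := re_segment_mem hτ hm ht
    have hc : HasDerivAt (fun w : ℂ => m + w * (t - m)) (1 * (t - m)) τ :=
      ((hasDerivAt_id (τ : ℂ)).mul_const (t - m)).const_add m
    have h := (HasDerivAt.comp (τ : ℂ) (hasDerivAt_lerchPrimitive hs.1 hs.2) hc).neg.comp_ofReal
    refine h.congr_deriv ?_
    ring
  rw [intervalIntegral.integral_eq_sub_of_hasDerivAt hder hint]
  simp only [Complex.ofReal_one, Complex.ofReal_zero, one_mul, zero_mul, add_zero,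
    add_sub_cancel]
  ring

theorem mainTheorem6 (m t : ℂ)
    (hm_re : -1 < m.re ∧ m.re ≤ -1 / 2) (hm_im : -1 < m.im ∧ m.im < -1 / 2)
    (ht_re : -1 < t.re ∧ t.re ≤ -1 / 2) (ht_im : -1 < t.im ∧ t.im < -1 / 2) :
    IntegrableOn (fun p : ℝ × ℝ => expLogIntegrand m t p.1 p.2) (Ioi 0 ×ˢ Ioi 0) ∧
    (∫ y in Ioi (0 : ℝ), (∫ x in Ioi (0 : ℝ), expLogIntegrand m t x y)) =
      (2 : ℂ) ^ m * Complex.exp (Complex.I * Real.pi * m) / Real.pi *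
        (2 * Real.pi * m * lerchPhi (Complex.exp (2 * Complex.I * m * Real.pi)) 1
            ((Real.pi - Complex.I * Real.log 2) / (2 * Real.pi))
          + Complex.I * lerchPhi (Complex.exp (2 * Complex.I * m * Real.pi)) 2
            ((Real.pi - Complex.I * Real.log 2) / (2 * Real.pi)))
      - (2 : ℂ) ^ t * Complex.exp (Complex.I * Real.pi * t) / Real.pi *
        (2 * Real.pi * t * lerchPhi (Complex.exp (2 * Complex.I * t * Real.pi)) 1
            ((Real.pi - Complex.I * Real.log 2) / (2 * Real.pi))
          + Complex.I * lerchPhi (Complex.exp (2 * Complex.I * t * Real.pi)) 2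
            ((Real.pi - Complex.I * Real.log 2) / (2 * Real.pi))) := by
  have hm : -1 < m.re ∧ m.re < 0 := ⟨hm_re.1, by linarith [hm_re.2]⟩
  have ht : -1 < t.re ∧ t.re < 0 := ⟨ht_re.1, by linarith [ht_re.2]⟩
  have hm' : -1 < m.re ∧ m.re < 1 := ⟨hm.1, hm.2.trans one_pos⟩
  have ht' : -1 < t.re ∧ t.re < 1 := ⟨ht.1, ht.2.trans one_pos⟩
  refine ⟨integrableOn_expLogIntegrand hm' ht', ?_⟩
  rw [integral_expLogIntegrand_eq hm' ht', integral_cpowSubDivLog_eq hm ht]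
  simp only [lerchPhi_one, lerchPhi_two]
  rfl
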